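/- Let $M$ be a Garside monoid. This means: $M$ is cancellative; $M$ is atomic (it is generated by its atoms, i.e. the elements $x\neq 1$ such that $x=yz$ implies $y=1$ or $z=1$, and for each $x\in M$ the lengths of the decompositions of $x$ into products of atoms are bounded); any two elements of $M$ have a left lcm, a right lcm, a left gcd and a right gcd; and $M$ contains a Garside element, i.e. an element whose left divisors and right divisors coincide, are finite in number, and generate $M$. Let $G$ be the group of fractions of $M$: $M$ embeds in $G$, and every element of $G$ has the form $x^{-1}y$ with $x,y\in M$. Then $G$ is biautomatic. More precisely, write $x\wedge y$ for the left gcd, $x\vee y$ for the right lcm, and $x\backslash y$ for the element with $x(x\backslash y)=x\vee y$. Let $S$ be the set of simple elements of $M$, i.e. the closure of the set of atoms under $\backslash$ and $\vee$. Then $S$ has a right lcm $\Delta$; put $x^*=x\backslash\Delta$ for $x\in S$. Let $L$ be the set of left normal forms (mixed canonical forms), i.e. of the words $$x_p^{-1}\cdots x_1^{-1}\,y_1\cdots y_q\qquad(p,q\ge 0)$$ over the alphabet $S\cup S^{-1}$ with $x_1,\dots,x_p,y_1,\dots,y_q\in S\setminus\{1\}$, $x_k^*\wedge x_{k+1}=1$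 for $1\le k<p$, $y_k^*\wedge y_{k+1}=1$ for $1\le k<q$, and $x_1\wedge y_1=1$ if $p,q\ge1$. Then: 1. Every element of $G$ is represented by exactly one word of $L$. 2. $L$ is the language of a biautomatic structure on $G$: the alphabet is finite and closed under inversion, $L$ is regular and represents every element of $G$, and, for each $g\in\{1\}\cup S\cup S^{-1}$, the sets of pairs $(u,v)\in L\times L$ with $\bar v=\bar u g$ and with $\bar v=g\bar u$ are regular languages of pairs (the two words being read synchronously, the shorter one padded at its end), where $\bar u$ denotes the element of $G$ represented by $u$. 3. $L$ has the $2$-fellow-traveller property on both sides. Let $d$ be the word distance of $G$ for the generators $S\cup S^{-1}$, and let $u(t)$ be the element represented by the prefix of length $t$ of $u$ (by $u$ itself, if $t$ exceeds the length of $u$). For all $u,v\in L$, all $g\in\{1\}\cup S\cup S^{-1}$ and all integers $t\ge0$: if $\bar v=\bar u g$, then $d(u(t),v(t))\le2$; and if $\bar v=g\bar u$, then $d(g\,u(t),v(t))\le2$. -/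

import Mathlib

namespace Garside

section Divisibility

variable {M : Type*} [Monoid M]

/-- `x` is a left divisor of `y` (and `y` is a right multiple of `x`). -/
def LDvd (x y : M) : Prop := ∃ z, x * z = y

/-- `x` is a right divisor of `y` (and `y` is a left multiple of `x`). -/
def RDvd (x y : M) : Prop := ∃ z, z * x = y

/-- `z` is a right lcm of `x` and `y`. -/
def IsRightLcm (x y z : M) : Prop :=
  LDvd x z ∧ LDvd y z ∧ ∀ m, LDvd x m → LDvd y m → LDvd z m

/-- `z` is a left lcm of `x` and `y`. -/
def IsLeftLcm (x y z : M) : Prop :=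
  RDvd x z ∧ RDvd y z ∧ ∀ m, RDvd x m → RDvd y m → RDvd z m

/-- `z` is a left gcd of `x` and `y`. -/
def IsLeftGcd (x y z : M) : Prop :=
  LDvd z x ∧ LDvd z y ∧ ∀ d, LDvd d x → LDvd d y → LDvd d z

/-- `z` is a right gcd of `x` and `y`. -/
def IsRightGcd (x y z : M) : Prop :=
  RDvd z x ∧ RDvd z y ∧ ∀ d, RDvd d x → RDvd d y → RDvd d z

/-- `z` is the right complement `x \ y`, i.e. `x * z` is the right lcm of `x` and `y`. -/
def IsRightCompl (x y z : M) : Prop := IsRightLcm x y (x * z)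

/-- `z` is a right lcm of the set `X`. -/
def IsRightLcmOfSet (X : Set M) (z : M) : Prop :=
  (∀ x ∈ X, LDvd x z) ∧ ∀ m, (∀ x ∈ X, LDvd x m) → LDvd z m

/-- Atoms: the elements `x ≠ 1` such that `x = y * z` implies `y = 1` or `z = 1`. -/
def IsAtomElt (x : M) : Prop := x ≠ 1 ∧ ∀ y z, x = y * z → y = 1 ∨ z = 1

/-- Garside elements: left and right divisors coincide, are finitely many, and generate. -/
structure IsGarsideElement (Δ : M) : Prop where
  divisors_eq : {x : M | LDvd x Δ} = {x : M | RDvd x Δ}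
  finite_divisors : {x : M | LDvd x Δ}.Finite
  generate : Submonoid.closure {x : M | LDvd x Δ} = ⊤

/-- Simple elements: the closure of the atoms under right complement and right lcm. -/
inductive IsSimple : M → Prop
  | atom {x : M} : IsAtomElt x → IsSimple x
  | compl {x y z : M} : IsSimple x → IsSimple y → IsRightCompl x y z → IsSimple z
  | lcm {x y z : M} : IsSimple x → IsSimple y → IsRightLcm x y z → IsSimple z

/-- For `Δ` the right lcm of the simple elements and `x` simple: `x^* ∧ y = 1`, where
`x^* = x \ Δ` and `∧` is the left gcd. -/
def StarCoprime (Δ x y : M) : Prop := ∃ c, IsRightCompl x Δ c ∧ IsLeftGcd c y 1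

end Divisibility

section Monoids

variable (M : Type*) [Monoid M]

/-- Atomic monoids: generated by the atoms, and for each `x` the lengths of the decompositions
of `x` into atoms are bounded. -/
structure IsAtomicMonoid : Prop where
  generate : Submonoid.closure {x : M | IsAtomElt x} = ⊤
  bounded : ∀ x : M, ∃ N : ℕ, ∀ l : List M, (∀ a ∈ l, IsAtomElt a) → l.prod = x → l.length ≤ N

/-- Gaussian monoids. -/
structure IsGaussianMonoid : Prop where
  atomic : IsAtomicMonoid M
  cancel : IsCancelMul M
  right_lcm : ∀ x y : M, ∃ z, IsRightLcm x y z
  left_lcm : ∀ x y : M, ∃ z, IsLeftLcm x y z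
  right_gcd : ∀ x y : M, ∃ z, IsRightGcd x y z
  left_gcd : ∀ x y : M, ∃ z, IsLeftGcd x y z

/-- Garside monoids: Gaussian monoids that contain a Garside element. -/
structure IsGarsideMonoid : Prop where
  gaussian : IsGaussianMonoid M
  garside : ∃ Δ : M, IsGarsideElement Δ

/-- The type of simple elements. -/
abbrev Simples : Type _ := {x : M // IsSimple x}

/-- Letters: `Sum.inl s` stands for `s`, and `Sum.inr s` for `s⁻¹`, with `s` simple. -/
abbrev Letter : Type _ := Simples M ⊕ Simples M

end Monoids

/-- `ι : M → G` makes `G` the group of fractions of `M`: it is an embedding, and every element of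
`G` is a fraction `x⁻¹ y` with `x`, `y` in `M`. -/
structure IsGroupOfFractions {M G : Type*} [Monoid M] [Group G] (ι : M →* G) : Prop where
  injective : Function.Injective ι
  fraction : ∀ g : G, ∃ x y : M, g = (ι x)⁻¹ * ι y

/-- The element of `G` that a letter represents. -/
def letterVal {M G : Type*} [Monoid M] [Group G] (ι : M →* G) : Letter M → G :=
  Sum.elim (fun s => ι s.1) (fun s => (ι s.1)⁻¹)

/-- `(x₁, …, x_p)` consists of simple elements different from `1` with `x_k^* ∧ x_{k+1} = 1`. -/
def IsNormalSeq {M : Type*} [Monoid M] (Δ : M) (l : List (Simples M)) : Prop :=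
  (∀ s ∈ l, s.1 ≠ 1) ∧ l.IsChain (fun s t => StarCoprime Δ s.1 t.1)

/-- The language of left normal forms: the words `x_p⁻¹ ⋯ x₁⁻¹ y₁ ⋯ y_q` with `(x₁, …, x_p)` and
`(y₁, …, y_q)` normal sequences, and with `x₁ ∧ y₁ = 1` if `p, q ≥ 1`. -/
def leftNormalForms {M : Type*} [Monoid M] (Δ : M) : Language (Letter M) :=
  {w | ∃ xs ys : List (Simples M), IsNormalSeq Δ xs ∧ IsNormalSeq Δ ys ∧
    (∀ x ∈ xs.head?, ∀ y ∈ ys.head?, IsLeftGcd x.1 y.1 1) ∧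
    w = xs.reverse.map Sum.inr ++ ys.map Sum.inl}

end Garside

namespace Automatic

variable {G A : Type*} [Group G]

/-- The element of `G` that a word represents. -/
def wordVal (ev : A → G) (w : List A) : G := (w.map ev).prod

/-- The pair `(u, v)` read synchronously, the shorter word being padded at its end (by `none`). -/
def padPair (u v : List A) : List (Option A × Option A) := List.zipWithAll Prod.mk u v

/-- Padded pairs `(u, v)` of words of `L` with `v = u g` in `G`. -/
def rightMultiplier (ev : A → G) (L : Language A) (g : G) : Language (Option A × Option A) :=
  {p | ∃ u ∈ L, ∃ v ∈ L, wordVal ev v = wordVal ev u * g ∧ p = padPair u v}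

/-- Padded pairs `(u, v)` of words of `L` with `v = g u` in `G`. -/
def leftMultiplier (ev : A → G) (L : Language A) (g : G) : Language (Option A × Option A) :=
  {p | ∃ u ∈ L, ∃ v ∈ L, wordVal ev v = g * wordVal ev u ∧ p = padPair u v}

/-- `L` is the language of a biautomatic structure on `G` over the finite alphabet `A`, closed
under inversion: `L` is regular, every element of `G` is represented by a word of `L`, and the
equality relation and the right and left multiplications by letters are recognized by finite
automata that read two words of `L` synchronously. -/
structure IsBiautomaticStructure (ev : A → G) (L : Language A) : Prop where
  finite_alphabet : Finite A
  inv_closed : ∀ a, ∃ b, ev b = (ev a)⁻¹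
  regular : L.IsRegular
  surjective : ∀ g : G, ∃ w ∈ L, wordVal ev w = g
  equality : (rightMultiplier ev L 1).IsRegular
  right_mul : ∀ a, (rightMultiplier ev L (ev a)).IsRegular
  left_mul : ∀ a, (leftMultiplier ev L (ev a)).IsRegular

/-- `G` is biautomatic: it has a biautomatic structure over some finite alphabet. -/
def IsBiautomaticGroup (G : Type*) [Group G] : Prop :=
  ∃ (n : ℕ) (ev : Fin n → G) (L : Language (Fin n)), IsBiautomaticStructure ev L

/-- The element `g` is represented by a word of length at most `k`. -/
def LengthLE (ev : A → G) (k : ℕ) (g : G) : Prop := ∃ w : List A, w.length ≤ k ∧ wordVal ev w = g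

/-- The word distance from `g` to `h` is at most `k` (for an alphabet closed under inversion). -/
def DistLE (ev : A → G) (k : ℕ) (g h : G) : Prop := LengthLE ev k (g⁻¹ * h)

/-- The `k`-fellow-traveller property of `L` for right multiplication: if the end points of
`u, v ∈ L` are at distance at most `1`, so that `v = u g`, the paths of `u` and `v` from `1`
stay at distance at most `k`. -/
def RightFellowTraveller (ev : A → G) (L : Language A) (k : ℕ) : Prop :=
  ∀ u ∈ L, ∀ v ∈ L, ∀ g, LengthLE ev 1 g → wordVal ev v = wordVal ev u * g →
    ∀ t : ℕ, DistLE ev k (wordVal ev (u.take t)) (wordVal ev (v.take t))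

/-- The `k`-fellow-traveller property of `L` for left multiplication: if `u, v ∈ L` and `v = g u`
with `g` of length at most `1`, the path of `u` from `g` and the path of `v` from `1` stay at
distance at most `k`. -/
def LeftFellowTraveller (ev : A → G) (L : Language A) (k : ℕ) : Prop :=
  ∀ u ∈ L, ∀ v ∈ L, ∀ g, LengthLE ev 1 g → wordVal ev v = g * wordVal ev u →
    ∀ t : ℕ, DistLE ev k (g * wordVal ev (u.take t)) (wordVal ev (v.take t))

end Automatic

/-!
Ordered by left divisibility, `G` is an inf-semilattice with a left-invariant order whose positive
cone is `M`; conjugation by `Δ` preserves the order, and every positive element is below a power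
of `Δ`. The greedy form `y₁ ⋯ y_q` of a positive `y` is characterized by `y₁ ⋯ y_n = y ⊓ Δⁿ`, and
the denominator of a fraction `g` in lowest terms is `(g ⊓ 1)⁻¹`. Hence the left normal form of `g`
exists and is unique, and its prefix of length `t` represents `g Δ^(p - t) ⊓ Δ^(t - p)` with
truncated subtractions, where `p` is the smallest exponent with `1 ≤ g Δ^p`. This expression
and `p` change by at most one factor in `[1, Δ]`, respectively by at most `1`, when `g` is
multiplied by a simple element on either side: the paths of normal forms `1`-fellow-travel. Finally,
a finite automaton that reads two fellow-travelling words only needs to remember the difference of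
their prefixes, which stays in a finite ball.
-/

namespace Automatic

section Regular

variable {α : Type*}

theorem isRegular_of_finite_states {σ : Type*} {K : Language α} {T : Set σ} (hT : T.Finite)
    (state : List α → σ) (state_mem : ∀ w z, w ++ z ∈ K → state w ∈ T)
    (mem_of_state_eq : ∀ w w', state w = state w' → ∀ z, w ++ z ∈ K → w' ++ z ∈ K) :
    K.IsRegular := by
  apply Language.IsRegular.of_finite_range_leftQuotient
  refine ((hT.image fun t => ({z | ∃ w, state w = t ∧ w ++ z ∈ K} : Language α)).insert
    (∅ : Set (List α))).subset ?_
  rintro _ ⟨w, rfl⟩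
  by_cases h : ∃ z, w ++ z ∈ K
  · obtain ⟨z, hz⟩ := h
    refine Or.inr ⟨state w, state_mem w z hz, ?_⟩
    ext y
    exact ⟨fun ⟨w', hw', hy⟩ => mem_of_state_eq w' w hw' y hy, fun hy => ⟨w, rfl, hy⟩⟩
  · exact Or.inl (Set.eq_empty_of_forall_notMem fun z hz => h ⟨z, hz⟩)

theorem append_mem_of_leftQuotient_eq {K : Language α} {w w' z : List α}
    (h : K.leftQuotient w = K.leftQuotient w') (hz : w ++ z ∈ K) : w' ++ z ∈ K := by
  rwa [← Language.mem_leftQuotient, ← h]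

/-- The local language of `P` and `R`: the words whose letters satisfy `P` and whose consecutive
letters are related by `R`. Padded words and left normal forms are languages of this kind. -/
def localLanguage (P : α → Prop) (R : α → α → Prop) : Language α :=
  {w | (∀ a ∈ w, P a) ∧ w.IsChain R}

theorem mem_localLanguage {P : α → Prop} {R : α → α → Prop} {w : List α} :
    w ∈ localLanguage P R ↔ (∀ a ∈ w, P a) ∧ w.IsChain R := Iff.rfl

theorem append_mem_localLanguage {P : α → Prop} {R : α → α → Prop} {w z : List α} :
    w ++ z ∈ localLanguage P R ↔ w ∈ localLanguage P R ∧ z ∈ localLanguage P R ∧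
      ∀ a ∈ w.getLast?, ∀ b ∈ z.head?, R a b := by
  simp only [mem_localLanguage, List.isChain_append, List.forall_mem_append]
  tauto

theorem isRegular_localLanguage [Finite α] (P : α → Prop) (R : α → α → Prop) :
    (localLanguage P R).IsRegular := by
  refine isRegular_of_finite_states (Set.toFinite Set.univ)
    (fun w => (w ∈ localLanguage P R, w.getLast?)) (fun _ _ _ => Set.mem_univ _) ?_
  intro w w' h z hz
  obtain ⟨hmem, hlast⟩ := Prod.mk.inj h
  rw [append_mem_localLanguage] at hz ⊢
  rwa [← hmem, ← hlast]

end Regular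

section Padding

variable {A : Type*}

/-- The relation between consecutive letters of a padded pair of words: once one of the two words
has ended, it only contributes padding symbols. -/
def PadStep (a b : Option A × Option A) : Prop :=
  (a.1 = none → b.1 = none) ∧ (a.2 = none → b.2 = none)

instance : IsTrans (Option A × Option A) PadStep :=
  ⟨fun _ _ _ h h' => ⟨h'.1 ∘ h.1, h'.2 ∘ h.2⟩⟩

/-- The range of `padPair`, written as a local language. -/
def paddedWords (A : Type*) : Language (Option A × Option A) :=
  localLanguage (· ≠ (none, none)) PadStep

theorem mem_paddedWords_iff_pairwise {p : List (Option A × Option A)} :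
    p ∈ paddedWords A ↔ (∀ a ∈ p, a ≠ (none, none)) ∧ p.Pairwise PadStep := by
  rw [paddedWords, mem_localLanguage, List.isChain_iff_pairwise]

theorem filterMap_fst_padPair (u v : List A) : (padPair u v).filterMap Prod.fst = u := by
  induction u generalizing v with
  | nil => simp [padPair]
  | cons a u ih =>
    cases v with
    | nil => simp [padPair]
    | cons b v => simpa [padPair] using ih v

theorem filterMap_snd_padPair (u v : List A) : (padPair u v).filterMap Prod.snd = v := by
  induction u generalizing v with
  | nil => simp [padPair]
  | cons a u ih =>
    cases v with
    | nil => simp [padPair]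
    | cons b v => simpa [padPair] using ih v

theorem take_padPair (u v : List A) (t : ℕ) :
    (padPair u v).take t = padPair (u.take t) (v.take t) := by
  induction u generalizing v t with
  | nil => simp [padPair]
  | cons a u ih =>
    cases t with
    | zero => simp [padPair]
    | succ t =>
      cases v with
      | nil => simp [padPair]
      | cons b v => simpa [padPair] using ih v t

theorem eq_padPair_take {u v : List A} {w z : List (Option A × Option A)}
    (h : w ++ z = padPair u v) : w = padPair (u.take w.length) (v.take w.length) := by
  rw [← take_padPair, ← h, List.take_left]

theorem padPair_mem_paddedWords (u v : List A) : padPair u v ∈ paddedWords A := by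
  rw [mem_paddedWords_iff_pairwise]
  induction u generalizing v with
  | nil => simp [padPair, List.pairwise_map, PadStep, List.pairwise_of_forall]
  | cons a u ih =>
    cases v with
    | nil => simp [padPair, List.pairwise_map, PadStep, List.pairwise_of_forall]
    | cons b v =>
      rw [padPair, List.zipWithAll_cons_cons, List.forall_mem_cons, List.pairwise_cons]
      exact ⟨⟨by simp, (ih v).1⟩, fun _ _ => ⟨by simp, by simp⟩, (ih v).2⟩

theorem padPair_filterMap {p : List (Option A × Option A)} (h : p ∈ paddedWords A) :
    padPair (p.filterMap Prod.fst) (p.filterMap Prod.snd) = p := by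
  rw [mem_paddedWords_iff_pairwise] at h
  induction p with
  | nil => rfl
  | cons a p ih =>
    obtain ⟨⟨ha, hp⟩, hstep, hpair⟩ := by
      simpa only [List.forall_mem_cons, List.pairwise_cons] using h
    have fst_eq_nil : a.1 = none → p.filterMap Prod.fst = [] := fun h0 =>
      List.filterMap_eq_nil_iff.2 fun b hb => (hstep b hb).1 h0
    have snd_eq_nil : a.2 = none → p.filterMap Prod.snd = [] := fun h0 =>
      List.filterMap_eq_nil_iff.2 fun b hb => (hstep b hb).2 h0
    have ih := ih ⟨hp, hpair⟩
    rcases a with ⟨_ | a, _ | b⟩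
    · exact absurd rfl ha
    · rw [fst_eq_nil rfl] at ih
      simpa [padPair, fst_eq_nil] using ih
    · rw [snd_eq_nil rfl] at ih
      simpa [padPair, snd_eq_nil] using ih
    · simpa [padPair] using ih

end Padding

section Multiplier

variable {G A : Type*} [Group G] {ev : A → G} {L : Language A}

theorem wordVal_append (ev : A → G) (u v : List A) :
    wordVal ev (u ++ v) = wordVal ev u * wordVal ev v := by
  simp [wordVal]

theorem LengthLE.mono {k l : ℕ} {g : G} (hkl : k ≤ l) (h : LengthLE ev k g) : LengthLE ev l g :=
  let ⟨w, hw, hg⟩ := h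
  ⟨w, hw.trans hkl, hg⟩

theorem finite_lengthLE [Finite A] (ev : A → G) (k : ℕ) : {g | LengthLE ev k g}.Finite := by
  refine ((List.finite_length_le A k).image (wordVal ev)).subset ?_
  rintro g ⟨w, hw, rfl⟩
  exact ⟨w, hw, rfl⟩

/-- Padded pairs `(u, v)` of words of `L` with `v = g u h` in `G`: the common generalization of the
right and left multiplier languages. -/
def twoSidedMultiplier (ev : A → G) (L : Language A) (g h : G) :
    Language (Option A × Option A) :=
  {p | ∃ u ∈ L, ∃ v ∈ L, wordVal ev v = g * wordVal ev u * h ∧ p = padPair u v}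

theorem mem_twoSidedMultiplier_iff {g h : G} {p : List (Option A × Option A)} :
    p ∈ twoSidedMultiplier ev L g h ↔
      p ∈ paddedWords A ∧ p.filterMap Prod.fst ∈ L ∧ p.filterMap Prod.snd ∈ L ∧
        wordVal ev (p.filterMap Prod.snd) = g * wordVal ev (p.filterMap Prod.fst) * h := by
  constructor
  · rintro ⟨u, hu, v, hv, huv, rfl⟩
    rw [filterMap_fst_padPair, filterMap_snd_padPair]
    exact ⟨padPair_mem_paddedWords u v, hu, hv, huv⟩
  · rintro ⟨hp, hu, hv, huv⟩
    exact ⟨_, hu, _, hv, huv, (padPair_filterMap hp).symm⟩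

/-- After reading the prefixes of length `t` of `u` and `v`, the automaton remembers the left
quotients and the difference `(g u(t))⁻¹ v(t)`, which stays in a finite ball. -/
theorem isRegular_twoSidedMultiplier [Finite A] (hL : L.IsRegular) (g h : G) (k : ℕ)
    (hft : ∀ u ∈ L, ∀ v ∈ L, wordVal ev v = g * wordVal ev u * h → ∀ t,
      DistLE ev k (g * wordVal ev (u.take t)) (wordVal ev (v.take t))) :
    (twoSidedMultiplier ev L g h).IsRegular := by
  have finite_quotients := hL.finite_range_leftQuotient
  refine isRegular_of_finite_states
    ((isRegular_localLanguage (· ≠ (none, none)) PadStep).finite_range_leftQuotient.prod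
      (finite_quotients.prod (finite_quotients.prod (finite_lengthLE ev k))))
    (fun w => ((paddedWords A).leftQuotient w, L.leftQuotient (w.filterMap Prod.fst),
      L.leftQuotient (w.filterMap Prod.snd),
      (g * wordVal ev (w.filterMap Prod.fst))⁻¹ * wordVal ev (w.filterMap Prod.snd))) ?_ ?_
  · rintro w z ⟨u, hu, v, hv, huv, hwz⟩
    refine ⟨⟨w, rfl⟩, ⟨_, rfl⟩, ⟨_, rfl⟩, ?_⟩
    have fst_eq := congrArg (List.filterMap Prod.fst) (eq_padPair_take hwz)
    have snd_eq := congrArg (List.filterMap Prod.snd) (eq_padPair_take hwz)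
    rw [filterMap_fst_padPair] at fst_eq
    rw [filterMap_snd_padPair] at snd_eq
    simp only [fst_eq, snd_eq]
    exact hft u hu v hv huv _
  · intro w w' hww z hz
    simp only [Prod.mk.injEq] at hww
    obtain ⟨pad_eq, fst_eq, snd_eq, diff_eq⟩ := hww
    have value_iff : ∀ a b c d : G, b * d = g * (a * c) * h ↔ (g * a)⁻¹ * b = c * h * d⁻¹ := by
      intro a b c d
      rw [eq_mul_inv_iff_mul_eq, mul_assoc (g * a)⁻¹, inv_mul_eq_iff_eq_mul]
      simp only [mul_assoc]
    simp only [mem_twoSidedMultiplier_iff, List.filterMap_append, wordVal_append,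
      value_iff] at hz ⊢
    obtain ⟨hpad, hfst, hsnd, hval⟩ := hz
    exact ⟨append_mem_of_leftQuotient_eq pad_eq hpad, append_mem_of_leftQuotient_eq fst_eq hfst,
      append_mem_of_leftQuotient_eq snd_eq hsnd, diff_eq ▸ hval⟩

end Multiplier

section Bicombing

variable {G A B : Type*} [Group G] {ev : A → G} {L : Language A} {k : ℕ}

theorem RightFellowTraveller.mono {l : ℕ} (hkl : k ≤ l) (h : RightFellowTraveller ev L k) :
    RightFellowTraveller ev L l :=
  fun u hu v hv g hg huv t => (h u hu v hv g hg huv t).mono hkl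

theorem LeftFellowTraveller.mono {l : ℕ} (hkl : k ≤ l) (h : LeftFellowTraveller ev L k) :
    LeftFellowTraveller ev L l :=
  fun u hu v hv g hg huv t => (h u hu v hv g hg huv t).mono hkl

theorem RightFellowTraveller.isRegular_rightMultiplier [Finite A]
    (hft : RightFellowTraveller ev L k) (hL : L.IsRegular) {g : G} (hg : LengthLE ev 1 g) :
    (rightMultiplier ev L g).IsRegular := by
  have hreg := isRegular_twoSidedMultiplier (ev := ev) hL 1 g k fun u hu v hv huv t => by
    rw [one_mul] at huv ⊢
    exact hft u hu v hv g hg huv t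
  simpa only [twoSidedMultiplier, rightMultiplier, one_mul] using hreg

theorem LeftFellowTraveller.isRegular_leftMultiplier [Finite A]
    (hft : LeftFellowTraveller ev L k) (hL : L.IsRegular) {g : G} (hg : LengthLE ev 1 g) :
    (leftMultiplier ev L g).IsRegular := by
  have hreg := isRegular_twoSidedMultiplier (ev := ev) hL g 1 k fun u hu v hv huv t => by
    rw [mul_one] at huv
    exact hft u hu v hv g hg huv t
  simpa only [twoSidedMultiplier, leftMultiplier, mul_one] using hreg

/-- A regular bicombing: a regular language of representatives, over an alphabet closed under
inversion, with both `k`-fellow-traveller properties. Over a finite alphabet this is a geometric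
criterion for biautomaticity. -/
structure IsRegularBicombing (ev : A → G) (L : Language A) (k : ℕ) : Prop where
  inv_closed : ∀ a, ∃ b, ev b = (ev a)⁻¹
  regular : L.IsRegular
  surjective : ∀ g : G, ∃ w ∈ L, wordVal ev w = g
  right_fellowTraveller : RightFellowTraveller ev L k
  left_fellowTraveller : LeftFellowTraveller ev L k

theorem IsRegularBicombing.isBiautomaticStructure [Finite A] (h : IsRegularBicombing ev L k) :
    IsBiautomaticStructure ev L where
  finite_alphabet := inferInstance
  inv_closed := h.inv_closed
  regular := h.regular
  surjective := h.surjective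
  equality := h.right_fellowTraveller.isRegular_rightMultiplier h.regular ⟨[], by simp, rfl⟩
  right_mul a := h.right_fellowTraveller.isRegular_rightMultiplier h.regular
    ⟨[a], by simp, by simp [wordVal]⟩
  left_mul a := h.left_fellowTraveller.isRegular_leftMultiplier h.regular
    ⟨[a], by simp, by simp [wordVal]⟩

theorem wordVal_comp (ev : A → G) (f : B → A) (w : List B) :
    wordVal (ev ∘ f) w = wordVal ev (w.map f) := by
  simp [wordVal]

theorem lengthLE_comp_equiv (e : B ≃ A) {g : G} :
    LengthLE (ev ∘ e) k g ↔ LengthLE ev k g := by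
  constructor
  · rintro ⟨w, hw, rfl⟩
    exact ⟨w.map e, by simpa using hw, (wordVal_comp ev e w).symm⟩
  · rintro ⟨w, hw, rfl⟩
    exact ⟨w.map e.symm, by simpa using hw, by simp [wordVal_comp]⟩

theorem IsRegularBicombing.comp_equiv (h : IsRegularBicombing ev L k) (e : B ≃ A) :
    IsRegularBicombing (ev ∘ e) (List.map e ⁻¹' L : Set (List B)) k where
  inv_closed b := by
    obtain ⟨a, ha⟩ := h.inv_closed (e b)
    exact ⟨e.symm a, by simpa using ha⟩
  regular := by
    obtain ⟨σ, hσ, automaton, rfl⟩ := h.regular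
    exact ⟨σ, hσ, automaton.comap e, automaton.accepts_comap e⟩
  surjective g := by
    obtain ⟨w, hw, hg⟩ := h.surjective g
    have map_map : (w.map e.symm).map e = w := by simp
    exact ⟨w.map e.symm, by rwa [← map_map] at hw, by rwa [wordVal_comp, map_map]⟩
  right_fellowTraveller u hu v hv g hg huv t := by
    rw [wordVal_comp, wordVal_comp] at huv
    rw [DistLE, lengthLE_comp_equiv, wordVal_comp, wordVal_comp, List.map_take, List.map_take]
    exact h.right_fellowTraveller _ hu _ hv g ((lengthLE_comp_equiv e).1 hg) huv t
  left_fellowTraveller u hu v hv g hg huv t := by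
    rw [wordVal_comp, wordVal_comp] at huv
    rw [DistLE, lengthLE_comp_equiv, wordVal_comp, wordVal_comp, List.map_take, List.map_take]
    exact h.left_fellowTraveller _ hu _ hv g ((lengthLE_comp_equiv e).1 hg) huv t

theorem IsRegularBicombing.isBiautomaticGroup [Finite A] (h : IsRegularBicombing ev L k) :
    IsBiautomaticGroup G := by
  obtain ⟨n, ⟨e⟩⟩ := Finite.exists_equiv_fin A
  exact ⟨n, ev ∘ e.symm, _, (h.comp_equiv e.symm).isBiautomaticStructure⟩

end Bicombing

end Automatic

namespace Garside

section MixedWord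

variable {G : Type*} [Group G]

/-- The word `x_p⁻¹ ⋯ x₁⁻¹ y₁ ⋯ y_q` of a pair of sequences. -/
def mixedWord (xs ys : List G) : List G := xs.reverse.map (·⁻¹) ++ ys

theorem prod_map_inv_reverse (l : List G) : (l.reverse.map (·⁻¹)).prod = l.prod⁻¹ := by
  rw [List.map_reverse, List.prod_inv_reverse]

theorem prod_mixedWord (xs ys : List G) : (mixedWord xs ys).prod = xs.prod⁻¹ * ys.prod := by
  rw [mixedWord, List.prod_append, prod_map_inv_reverse]

theorem prod_take_map_inv_reverse (l : List G) (t : ℕ) :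
    ((l.reverse.map (·⁻¹)).take t).prod = l.prod⁻¹ * (l.take (l.length - t)).prod := by
  rw [← List.map_take, List.take_reverse, prod_map_inv_reverse, eq_inv_mul_iff_mul_eq,
    mul_inv_eq_iff_eq_mul, List.prod_take_mul_prod_drop]

end MixedWord

section LeftOrderedGroup

variable {G : Type*} [Group G] [SemilatticeInf G] {D g s a b : G} {l l' xs ys xs' ys' : List G}

/-- The order-theoretic properties of a Garside element `D` in its group of fractions, ordered by
left divisibility: `D` is positive, right multiplication by `D` (equivalently, conjugation by `D`,
if the order is left invariant) is an order embedding, and the powers of `D` are cofinal. -/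
structure IsQuasiCentralUnit (D : G) : Prop where
  one_le : 1 ≤ D
  mul_le_mul_iff : ∀ a b, a * D ≤ b * D ↔ a ≤ b
  exists_le_pow : ∀ a, 1 ≤ a → ∃ n : ℕ, a ≤ D ^ n

/-- Greedy sequences: sequences of elements of `(1, D]` such that each term is the largest lower
bound of `D` and of the product of itself with the next term. -/
def IsGreedy (D : G) (l : List G) : Prop :=
  (∀ s ∈ l, s ∈ Set.Ioc 1 D) ∧ l.IsChain (fun s t => s * t ⊓ D = s)

/-- Pairs of greedy sequences whose first terms are coprime; they represent the fraction
`xs.prod⁻¹ * ys.prod`, which they put in lowest terms. -/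
structure IsMixedForm (D : G) (xs ys : List G) : Prop where
  left : IsGreedy D xs
  right : IsGreedy D ys
  coprime : ∀ x ∈ xs.head?, ∀ y ∈ ys.head?, x ⊓ y = 1

/-- The length of the denominator of the mixed form of `g`, in a description that only involves
the order: the smallest `n` such that `g * D ^ n` is positive. -/
noncomputable def denLength (D g : G) : ℕ := sInf {n | 1 ≤ g * D ^ n}

/-- The point at time `t` of the path from `1` to `g` that is described by the mixed form of `g`.
One of the two truncated subtractions vanishes: the path first follows `g * D ^ n ⊓ 1` with `n`
decreasing to `0`, then `g ⊓ D ^ n` with `n` increasing from `0`. -/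
noncomputable def mixedPath (D g : G) (t : ℕ) : G :=
  g * D ^ (denLength D g - t) ⊓ D ^ (t - denLength D g)

/-- The elements `a` and `b` differ by right multiplication by an element of `[1, D]`. -/
def IsAdjacent (D a b : G) : Prop := a ≤ b ∧ b ≤ a * D ∨ b ≤ a ∧ a ≤ b * D

namespace IsQuasiCentralUnit

variable (hD : IsQuasiCentralUnit D)
include hD

theorem mul_pow_le_mul_pow_iff (n : ℕ) : a * D ^ n ≤ b * D ^ n ↔ a ≤ b := by
  induction n with
  | zero => simp
  | succ n ih => rw [pow_succ, ← mul_assoc, ← mul_assoc, hD.mul_le_mul_iff, ih]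

theorem mul_pow_le_pow_succ (hs : s ≤ D) (n : ℕ) : s * D ^ n ≤ D ^ (n + 1) := by
  rwa [pow_succ', hD.mul_pow_le_mul_pow_iff]

theorem pow_le_mul_pow (hs : 1 ≤ s) (n : ℕ) : D ^ n ≤ s * D ^ n := by
  simpa only [one_mul] using (hD.mul_pow_le_mul_pow_iff n).2 hs

theorem inf_mul_pow (a b : G) (n : ℕ) : (a ⊓ b) * D ^ n = a * D ^ n ⊓ b * D ^ n :=
  let mulRight : G ≃o G := ⟨Equiv.mulRight (D ^ n), hD.mul_pow_le_mul_pow_iff n⟩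
  mulRight.map_inf a b

theorem inf_mul (a b : G) : (a ⊓ b) * D = a * D ⊓ b * D := by
  simpa only [pow_one] using hD.inf_mul_pow a b 1

end IsQuasiCentralUnit

theorem IsGreedy.tail (h : IsGreedy D (s :: l)) : IsGreedy D l :=
  ⟨fun t ht => h.1 t (List.mem_cons_of_mem s ht), h.2.tail⟩

theorem IsGreedy.drop (h : IsGreedy D l) (n : ℕ) : IsGreedy D (l.drop n) :=
  ⟨fun t ht => h.1 t (List.mem_of_mem_drop ht), h.2.drop n⟩

theorem IsAdjacent.symm (h : IsAdjacent D a b) : IsAdjacent D b a := Or.symm h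

variable [MulLeftMono G]

theorem mul_inf_distrib (c a b : G) : c * (a ⊓ b) = c * a ⊓ c * b :=
  (OrderIso.mulLeft c).map_inf a b

theorem IsAdjacent.mul_left (h : IsAdjacent D a b) (c : G) : IsAdjacent D (c * a) (c * b) := by
  simpa only [IsAdjacent, mul_assoc, mul_le_mul_iff_left] using h

theorem isAdjacent_iff : IsAdjacent D a b ↔ a⁻¹ * b ∈ Set.Icc 1 D ∨ (a⁻¹ * b)⁻¹ ∈ Set.Icc 1 D := by
  simp only [IsAdjacent, Set.mem_Icc, mul_inv_rev, inv_inv, le_inv_mul_iff_le,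
    inv_mul_le_iff_le_mul]

theorem IsGreedy.one_le_prod (h : IsGreedy D l) : 1 ≤ l.prod := by
  induction l with
  | nil => simp
  | cons s l ih =>
    rw [List.prod_cons]
    exact one_le_mul (h.1 s List.mem_cons_self).1.le (ih h.tail)

theorem IsGreedy.cons (h : IsGreedy D l) (hs : 1 < s) (hsl : s * l.prod ⊓ D = s) :
    IsGreedy D (s :: l) := by
  refine ⟨List.forall_mem_cons.2 ⟨⟨hs, inf_eq_left.1 ?_⟩, h.1⟩, List.isChain_cons.2 ⟨?_, h.2⟩⟩
  · rw [← hsl, inf_assoc, inf_idem]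
  · rcases l with _ | ⟨t, l⟩
    · simp
    · rintro _ ⟨⟩
      apply le_antisymm
      · calc s * t ⊓ D ≤ s * (t :: l).prod ⊓ D := by
              rw [List.prod_cons]
              gcongr
              exact le_mul_of_one_le_right' h.tail.one_le_prod
          _ = s := hsl
      · exact le_inf (le_mul_of_one_le_right' (h.1 t List.mem_cons_self).1.le)
          (inf_eq_left.1 (by rw [← hsl, inf_assoc, inf_idem]))

namespace IsQuasiCentralUnit

variable (hD : IsQuasiCentralUnit D)
include hD

theorem one_le_pow (n : ℕ) : 1 ≤ D ^ n := one_le_pow_of_one_le' hD.one_le n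

theorem le_mul_pow (a : G) (n : ℕ) : a ≤ a * D ^ n := le_mul_of_one_le_right' (hD.one_le_pow n)

theorem pow_le_pow {m n : ℕ} (h : m ≤ n) : D ^ m ≤ D ^ n := pow_le_pow_right' hD.one_le h

theorem inf_pow_succ (y : G) (n : ℕ) : y ⊓ D ^ (n + 1) = y ⊓ (y ⊓ D) * D ^ n := by
  rw [hD.inf_mul_pow, ← inf_assoc, inf_eq_left.2 (hD.le_mul_pow y n), pow_succ']

theorem prod_inf_eq_head (h : IsGreedy D (s :: l)) : (s :: l).prod ⊓ D = s := by
  induction l generalizing s with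
  | nil => simpa using (h.1 s List.mem_cons_self).2
  | cons t l ih =>
    have hst : s * t ⊓ D = s := (List.isChain_cons.1 h.2).1 t rfl
    have hle : D ≤ s * D := by
      simpa only [pow_one] using hD.pow_le_mul_pow (h.1 s List.mem_cons_self).1.le 1
    calc (s :: t :: l).prod ⊓ D = s * (t :: l).prod ⊓ s * D ⊓ D := by
          rw [List.prod_cons, inf_assoc, inf_eq_right.2 hle]
      _ = s := by rw [← mul_inf_distrib, ih h.tail, hst]

theorem prod_inf_pow (h : IsGreedy D l) (n : ℕ) : l.prod ⊓ D ^ n = (l.take n).prod := by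
  induction n generalizing l with
  | zero => simpa using h.one_le_prod
  | succ n ih =>
    cases l with
    | nil => simpa using hD.one_le_pow (n + 1)
    | cons s l =>
      rw [hD.inf_pow_succ, hD.prod_inf_eq_head h, List.prod_cons, ← mul_inf_distrib, ih h.tail,
        List.take_succ_cons, List.prod_cons]

theorem eq_nil_of_prod_eq_one (h : IsGreedy D l) (h1 : l.prod = 1) : l = [] := by
  cases l with
  | nil => rfl
  | cons s l =>
    have one_eq : 1 = s := by
      rw [← hD.prod_inf_eq_head h, h1, inf_eq_left.2 hD.one_le]
    exact absurd one_eq (h.1 s List.mem_cons_self).1.ne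

theorem eq_of_prod_eq (h : IsGreedy D l) (h' : IsGreedy D l') (hprod : l.prod = l'.prod) :
    l = l' := by
  induction l generalizing l' with
  | nil => exact (hD.eq_nil_of_prod_eq_one h' hprod.symm).symm
  | cons s l ih =>
    cases l' with
    | nil => exact hD.eq_nil_of_prod_eq_one h hprod
    | cons s' l' =>
      obtain rfl : s = s' := by
        rw [← hD.prod_inf_eq_head h, hprod, hD.prod_inf_eq_head h']
      rw [ih h.tail h'.tail (by simpa using hprod)]

theorem exists_isGreedy {y : G} (hy : 1 ≤ y) : ∃ l, IsGreedy D l ∧ l.prod = y := by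
  obtain ⟨n, hn⟩ := hD.exists_le_pow y hy
  induction n generalizing y with
  | zero => exact ⟨[], ⟨by simp, by simp⟩, (le_antisymm (by simpa using hn) hy).symm⟩
  | succ n ih =>
    set s := y ⊓ D
    have quotient_le : s⁻¹ * y ≤ D ^ n := by
      rw [inv_mul_le_iff_le_mul, ← inf_eq_left, ← hD.inf_pow_succ, inf_eq_left]
      exact hn
    obtain ⟨l, hl, hly⟩ := ih (le_inv_mul_iff_le.2 inf_le_left) quotient_le
    have mul_prod : s * l.prod = y := by rw [hly, mul_inv_cancel_left]
    have one_le : 1 ≤ s := le_inf hy hD.one_le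
    rcases one_le.eq_or_lt with h1 | h1
    · exact ⟨l, hl, by simpa only [← h1, one_mul] using mul_prod⟩
    · exact ⟨s :: l, hl.cons h1 (by rw [mul_prod]), by rw [List.prod_cons, mul_prod]⟩

theorem eq_one_of_inf_eq_one {y : G} (hy : 1 ≤ y) (h : y ⊓ D = 1) : y = 1 := by
  obtain ⟨l, hl, rfl⟩ := hD.exists_isGreedy hy
  cases l with
  | nil => rfl
  | cons s l => exact absurd (hD.prod_inf_eq_head hl ▸ h) (hl.1 s List.mem_cons_self).1.ne'

theorem prod_inf_prod_eq_one_iff (hx : IsGreedy D xs) (hy : IsGreedy D ys) :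
    xs.prod ⊓ ys.prod = 1 ↔ ∀ x ∈ xs.head?, ∀ y ∈ ys.head?, x ⊓ y = 1 := by
  rcases xs with _ | ⟨x, xs⟩
  · simpa using hy.one_le_prod
  rcases ys with _ | ⟨y, ys⟩
  · simpa using hx.one_le_prod
  have inf_inf : (x :: xs).prod ⊓ (y :: ys).prod ⊓ D = x ⊓ y := by
    rw [inf_inf_distrib_right, hD.prod_inf_eq_head hx, hD.prod_inf_eq_head hy]
  simp only [List.head?_cons, Option.mem_some_iff, forall_eq']
  rw [← inf_inf]
  exact ⟨fun h => by rw [h, inf_eq_left.2 hD.one_le],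
    hD.eq_one_of_inf_eq_one (le_inf hx.one_le_prod hy.one_le_prod)⟩

theorem inf_one_of_isMixedForm (h : IsMixedForm D xs ys) :
    xs.prod⁻¹ * ys.prod ⊓ 1 = xs.prod⁻¹ := by
  have coprime := (hD.prod_inf_prod_eq_one_iff h.left h.right).2 h.coprime
  calc xs.prod⁻¹ * ys.prod ⊓ 1 = xs.prod⁻¹ * (xs.prod ⊓ ys.prod) := by
        rw [mul_inf_distrib, inv_mul_cancel, inf_comm]
    _ = xs.prod⁻¹ := by rw [coprime, mul_one]

theorem eq_of_isMixedForm (h : IsMixedForm D xs ys) (h' : IsMixedForm D xs' ys')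
    (hprod : xs.prod⁻¹ * ys.prod = xs'.prod⁻¹ * ys'.prod) : xs = xs' ∧ ys = ys' := by
  have hx : xs.prod = xs'.prod := by
    rw [← inv_inj, ← hD.inf_one_of_isMixedForm h, ← hD.inf_one_of_isMixedForm h', hprod]
  rw [hx] at hprod
  exact ⟨hD.eq_of_prod_eq h.left h'.left hx,
    hD.eq_of_prod_eq h.right h'.right (mul_left_cancel hprod)⟩

theorem exists_isMixedForm (g : G) : ∃ xs ys, IsMixedForm D xs ys ∧ xs.prod⁻¹ * ys.prod = g := by
  set x := (g ⊓ 1)⁻¹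
  have one_le_num : 1 ≤ x * g := le_inv_mul_iff_le.2 inf_le_left
  obtain ⟨xs, hxs, hxp⟩ := hD.exists_isGreedy (one_le_inv'.2 inf_le_right : 1 ≤ x)
  obtain ⟨ys, hys, hyp⟩ := hD.exists_isGreedy one_le_num
  refine ⟨xs, ys, ⟨hxs, hys, (hD.prod_inf_prod_eq_one_iff hxs hys).1 ?_⟩, ?_⟩
  · calc xs.prod ⊓ ys.prod = x * (g ⊓ 1) := by
          rw [hxp, hyp, mul_inf_distrib, mul_one, inf_comm]
      _ = 1 := inv_mul_cancel _
  · rw [hxp, hyp, inv_mul_cancel_left]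

theorem exists_one_le_mul_pow (g : G) : ∃ n : ℕ, 1 ≤ g * D ^ n := by
  obtain ⟨n, hn⟩ := hD.exists_le_pow (g ⊓ 1)⁻¹ (one_le_inv'.2 inf_le_right)
  exact ⟨n, (inv_le_iff_one_le_mul'.1 hn).trans ((hD.mul_pow_le_mul_pow_iff n).2 inf_le_left)⟩

theorem denLength_le_iff {n : ℕ} : denLength D g ≤ n ↔ 1 ≤ g * D ^ n := by
  refine ⟨fun h => ?_, fun h => Nat.sInf_le h⟩
  have one_le : 1 ≤ g * D ^ denLength D g := Nat.sInf_mem (hD.exists_one_le_mul_pow g)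
  exact one_le.trans (mul_le_mul_right (hD.pow_le_pow h) g)

theorem denLength_mul_right (hs : s ∈ Set.Icc 1 D) :
    denLength D (g * s) = denLength D g ∨ denLength D (g * s) + 1 = denLength D g := by
  have le : denLength D (g * s) ≤ denLength D g := by
    rw [hD.denLength_le_iff, mul_assoc]
    exact (hD.denLength_le_iff.1 le_rfl).trans (mul_le_mul_right (hD.pow_le_mul_pow hs.1 _) g)
  have ge : denLength D g ≤ denLength D (g * s) + 1 := by
    rw [hD.denLength_le_iff]
    calc 1 ≤ g * s * D ^ denLength D (g * s) := hD.denLength_le_iff.1 le_rfl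
      _ ≤ g * D ^ (denLength D (g * s) + 1) := by
        rw [mul_assoc]
        exact mul_le_mul_right (hD.mul_pow_le_pow_succ hs.2 _) g
  lia

theorem denLength_mul_left (hs : s ∈ Set.Icc 1 D) :
    denLength D (s * g) = denLength D g ∨ denLength D (s * g) + 1 = denLength D g := by
  have le : denLength D (s * g) ≤ denLength D g := by
    rw [hD.denLength_le_iff, mul_assoc]
    exact one_le_mul hs.1 (hD.denLength_le_iff.1 le_rfl)
  have ge : denLength D g ≤ denLength D (s * g) + 1 := by
    rw [hD.denLength_le_iff, ← mul_le_mul_iff_left s, mul_one]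
    calc s ≤ 1 * D := by rw [one_mul]; exact hs.2
      _ ≤ s * g * D ^ denLength D (s * g) * D :=
        (hD.mul_le_mul_iff _ _).2 (hD.denLength_le_iff.1 le_rfl)
      _ = s * (g * D ^ (denLength D (s * g) + 1)) := by
        rw [pow_succ]
        simp only [mul_assoc]
  lia

theorem inv_prod_mul_pow_of_isMixedForm (h : IsMixedForm D xs ys) (n : ℕ) :
    xs.prod⁻¹ * D ^ n = xs.prod⁻¹ * ys.prod * D ^ n ⊓ D ^ n := by
  conv_lhs => rw [← hD.inf_one_of_isMixedForm h, hD.inf_mul_pow, one_mul]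

theorem denLength_of_isMixedForm (h : IsMixedForm D xs ys) :
    denLength D (xs.prod⁻¹ * ys.prod) = xs.length := by
  refine eq_of_forall_ge_iff fun n => ?_
  calc denLength D (xs.prod⁻¹ * ys.prod) ≤ n
      ↔ 1 ≤ xs.prod⁻¹ * D ^ n := by
        rw [hD.denLength_le_iff, hD.inv_prod_mul_pow_of_isMixedForm h, le_inf_iff,
          and_iff_left (hD.one_le_pow n)]
    _ ↔ (xs.take n).prod = xs.prod := by
      rw [le_inv_mul_iff_le, ← hD.prod_inf_pow h.left, inf_eq_left]
    _ ↔ (xs.drop n).prod = 1 := by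
      conv_lhs => rw [← List.prod_take_mul_prod_drop xs n, left_eq_mul]
    _ ↔ xs.length ≤ n := by
      rw [← List.drop_eq_nil_iff]
      exact ⟨hD.eq_nil_of_prod_eq_one (h.left.drop n), fun hn => by rw [hn, List.prod_nil]⟩

theorem prod_take_mixedWord (h : IsMixedForm D xs ys) (t : ℕ) :
    ((mixedWord xs ys).take t).prod = mixedPath D (xs.prod⁻¹ * ys.prod) t := by
  rw [mixedWord, mixedPath, hD.denLength_of_isMixedForm h, List.take_append, List.prod_append,
    List.length_map, List.length_reverse, prod_take_map_inv_reverse]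
  set g := xs.prod⁻¹ * ys.prod with hg
  rcases le_total t xs.length with ht | ht
  · rw [Nat.sub_eq_zero_of_le ht, List.take_zero, List.prod_nil, mul_one, pow_zero,
      ← hD.prod_inf_pow h.left, mul_inf_distrib, inv_mul_cancel,
      hD.inv_prod_mul_pow_of_isMixedForm h, inf_comm, inf_assoc, inf_eq_right.2 (hD.one_le_pow _)]
  · rw [Nat.sub_eq_zero_of_le ht, List.take_zero, List.prod_nil, mul_one, pow_zero, mul_one,
      ← hD.prod_inf_pow h.right, mul_inf_distrib, hD.inv_prod_mul_pow_of_isMixedForm h, ← hg,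
      ← inf_assoc, inf_eq_left.2 (hD.le_mul_pow _ _)]

theorem isAdjacent_mixedPath_mul_right_of_mem_Icc (g : G) (hs : s ∈ Set.Icc 1 D) (t : ℕ) :
    IsAdjacent D (mixedPath D g t) (mixedPath D (g * s) t) := by
  have lower (n : ℕ) : g * D ^ n ≤ g * s * D ^ n := by
    rw [mul_assoc]
    exact mul_le_mul_right (hD.pow_le_mul_pow hs.1 n) g
  have upper (n : ℕ) : g * s * D ^ n ≤ g * D ^ (n + 1) := by
    rw [mul_assoc]
    exact mul_le_mul_right (hD.mul_pow_le_pow_succ hs.2 n) g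
  simp only [IsAdjacent, mixedPath, hD.inf_mul, mul_assoc _ _ D, ← pow_succ]
  rcases hD.denLength_mul_right (g := g) hs with h | h
  · rw [h]
    exact .inl ⟨inf_le_inf_right _ (lower _), inf_le_inf (upper _) (hD.pow_le_pow (by lia))⟩
  rw [← h]
  set p := denLength D (g * s)
  rcases Nat.lt_or_ge t (p + 1) with ht | ht
  · rw [show p + 1 - t = p - t + 1 by lia, show t - (p + 1) = 0 by lia,
      show t - p = 0 by lia]
    exact .inr ⟨inf_le_inf_right _ (upper _), inf_le_inf (lower _) (hD.pow_le_pow (by lia))⟩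
  · rw [show p + 1 - t = 0 by lia, show p - t = 0 by lia,
      show t - p = t - (p + 1) + 1 by lia]
    exact .inl ⟨inf_le_inf (lower _) (hD.pow_le_pow (by lia)), inf_le_inf_right _ (upper _)⟩

theorem isAdjacent_mixedPath_mul_left_of_mem_Icc (g : G) (hs : s ∈ Set.Icc 1 D) (t : ℕ) :
    IsAdjacent D (s * mixedPath D g t) (mixedPath D (s * g) t) := by
  have mono {m n : ℕ} (h : m ≤ n) : s * g * D ^ m ≤ s * g * D ^ n :=
    mul_le_mul_right (hD.pow_le_pow h) _
  have lower := hD.pow_le_mul_pow hs.1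
  have upper := hD.mul_pow_le_pow_succ hs.2
  simp only [IsAdjacent, mixedPath, hD.inf_mul, mul_inf_distrib, mul_assoc _ _ D, ← pow_succ,
    ← mul_assoc s g]
  rcases hD.denLength_mul_left (g := g) hs with h | h
  · rw [h]
    exact .inr ⟨inf_le_inf_left _ (lower _), inf_le_inf (mono (by lia)) (upper _)⟩
  rw [← h]
  set p := denLength D (s * g)
  rcases Nat.lt_or_ge t (p + 1) with ht | ht
  · rw [show t - (p + 1) = 0 by lia, show t - p = 0 by lia]
    exact .inr ⟨inf_le_inf (mono (by lia)) (lower _), inf_le_inf (mono (by lia)) (upper _)⟩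
  · rw [show t - p = t - (p + 1) + 1 by lia]
    exact .inl ⟨inf_le_inf (mono (by lia)) (upper _), inf_le_inf (mono (by lia)) (lower _)⟩

theorem isAdjacent_mixedPath_mul_right (g : G) (hs : IsAdjacent D 1 s) (t : ℕ) :
    IsAdjacent D (mixedPath D g t) (mixedPath D (g * s) t) := by
  rw [isAdjacent_iff, inv_one, one_mul] at hs
  rcases hs with hs | hs
  · exact hD.isAdjacent_mixedPath_mul_right_of_mem_Icc g hs t
  · simpa only [mul_inv_cancel_right] using
      (hD.isAdjacent_mixedPath_mul_right_of_mem_Icc (g * s) hs t).symm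

theorem isAdjacent_mixedPath_mul_left (g : G) (hs : IsAdjacent D 1 s) (t : ℕ) :
    IsAdjacent D (s * mixedPath D g t) (mixedPath D (s * g) t) := by
  rw [isAdjacent_iff, inv_one, one_mul] at hs
  rcases hs with hs | hs
  · exact hD.isAdjacent_mixedPath_mul_left_of_mem_Icc g hs t
  · simpa only [inv_mul_cancel_left, mul_inv_cancel_left] using
      ((hD.isAdjacent_mixedPath_mul_left_of_mem_Icc (s * g) hs t).mul_left s).symm

end IsQuasiCentralUnit

end LeftOrderedGroup

section Monoid

variable {M : Type*} [Monoid M] {D x y z : M}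

theorem LDvd.refl (x : M) : LDvd x x := ⟨1, mul_one x⟩

theorem LDvd.trans (h : LDvd x y) (h' : LDvd y z) : LDvd x z := by
  obtain ⟨a, rfl⟩ := h
  obtain ⟨b, rfl⟩ := h'
  exact ⟨a * b, (mul_assoc _ _ _).symm⟩

instance : IsTrans M LDvd := ⟨fun _ _ _ => LDvd.trans⟩

theorem one_lDvd (x : M) : LDvd 1 x := ⟨x, one_mul x⟩

namespace IsAtomicMonoid

variable (hM : IsAtomicMonoid M)
include hM

theorem exists_atoms (x : M) : ∃ l : List M, (∀ a ∈ l, IsAtomElt a) ∧ l.prod = x := by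
  have mem_closure : x ∈ Submonoid.closure {x : M | IsAtomElt x} := hM.generate ▸ trivial
  exact Submonoid.exists_list_of_mem_closure mem_closure

/-- Otherwise `x = x (y z)ⁿ` would give decompositions of `x` into arbitrarily many atoms. -/
theorem eq_one_of_mul_mul_eq_self (h : x * (y * z) = x) : y = 1 ∧ z = 1 := by
  obtain ⟨lx, hlx, hx⟩ := hM.exists_atoms x
  obtain ⟨ly, hly, rfl⟩ := hM.exists_atoms y
  obtain ⟨lz, hlz, rfl⟩ := hM.exists_atoms z
  obtain ⟨N, hN⟩ := hM.bounded x
  have mul_pow_eq (n : ℕ) : x * (ly.prod * lz.prod) ^ n = x := by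
    induction n with
    | zero => rw [pow_zero, mul_one]
    | succ n ih => rw [pow_succ', ← mul_assoc, h, ih]
  have length_le := hN (lx ++ (List.replicate (N + 1) (ly ++ lz)).flatten)
    (by
      simp only [List.mem_append, List.mem_flatten, List.mem_replicate]
      rintro a (ha | ⟨_, ⟨-, rfl⟩, ha⟩)
      · exact hlx a ha
      · exact (List.mem_append.1 ha).elim (hly a) (hlz a))
    (by
      rw [List.prod_append, List.prod_flatten, List.map_replicate, List.prod_replicate,
        List.prod_append, hx, mul_pow_eq])
  rw [List.length_append, List.length_flatten, List.map_replicate, List.sum_replicate,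
    List.length_append, smul_eq_mul] at length_le
  have length_eq_zero : ly.length + lz.length = 0 := by nlinarith
  obtain ⟨rfl, rfl⟩ : ly = [] ∧ lz = [] := by simpa using length_eq_zero
  exact ⟨rfl, rfl⟩

theorem eq_one_of_mul_eq_one (h : x * y = 1) : x = 1 ∧ y = 1 :=
  hM.eq_one_of_mul_mul_eq_self (x := 1) (by rw [one_mul, h])

theorem lDvd_antisymm (h : LDvd x y) (h' : LDvd y x) : x = y := by
  obtain ⟨a, rfl⟩ := h
  obtain ⟨b, hb⟩ := h'
  rw [mul_assoc] at hb
  rw [(hM.eq_one_of_mul_mul_eq_self hb).1, mul_one]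

/-- A common left divisor with as many atoms as possible absorbs every other one, since its right
lcm with it is again a common left divisor. -/
theorem exists_isLeftGcd (hlcm : ∀ x y : M, ∃ z, IsRightLcm x y z) (x y : M) :
    ∃ d, IsLeftGcd x y d := by
  let lengths : Set ℕ := {n | ∃ l : List M, (∀ a ∈ l, IsAtomElt a) ∧ LDvd l.prod x ∧
    LDvd l.prod y ∧ l.length = n}
  have bddAbove : BddAbove lengths := by
    obtain ⟨N, hN⟩ := hM.bounded x
    refine ⟨N, ?_⟩
    rintro _ ⟨l, hl, ⟨z, hz⟩, -, rfl⟩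
    obtain ⟨l', hl', rfl⟩ := hM.exists_atoms z
    have length_le := hN (l ++ l') (List.forall_mem_append.2 ⟨hl, hl'⟩) (by simpa using hz)
    rw [List.length_append] at length_le
    lia
  obtain ⟨_, ⟨l, hl, hx, hy, rfl⟩, hmax⟩ :=
    bddAbove.exists_isGreatest_of_nonempty ⟨0, [], by simp, one_lDvd x, one_lDvd y, rfl⟩
  refine ⟨l.prod, hx, hy, fun e hex hey => ?_⟩
  obtain ⟨f, ⟨k, rfl⟩, hef, hf⟩ := hlcm l.prod e
  obtain ⟨l', hl', rfl⟩ := hM.exists_atoms k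
  have length_le : (l ++ l').length ≤ l.length :=
    hmax ⟨l ++ l', List.forall_mem_append.2 ⟨hl, hl'⟩, by simpa using hf x hx hex,
      by simpa using hf y hy hey, rfl⟩
  obtain rfl : l' = [] := by simpa using length_le
  simpa using hef

end IsAtomicMonoid

/-- Being simple or trivial; the difference matters for the trivial monoid only. -/
def IsSimpleOrOne (x : M) : Prop := x = 1 ∨ IsSimple x

theorem IsSimpleOrOne.of_mul_left (hM : IsAtomicMonoid M) (y : M) (h : IsSimpleOrOne (y * z)) :
    IsSimpleOrOne z := by
  induction y using Submonoid.dense_induction _ hM.generate generalizing z with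
  | one => rwa [one_mul] at h
  | mem a ha =>
    rcases h with h | h
    · exact .inl (hM.eq_one_of_mul_eq_one h).2
    · exact .inr (.compl (.atom ha) h ⟨⟨z, rfl⟩, LDvd.refl _, fun _ _ hm => hm⟩)
  | mul x y hx hy =>
    rw [mul_assoc] at h
    exact hy (hx h)

theorem IsSimpleOrOne.rightLcm (hM : IsAtomicMonoid M) (hx : IsSimpleOrOne x)
    (hy : IsSimpleOrOne y) (h : IsRightLcm x y z) : IsSimpleOrOne z := by
  rcases hx with rfl | hx
  · rwa [hM.lDvd_antisymm (h.2.2 y (one_lDvd y) (LDvd.refl y)) h.2.1]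
  rcases hy with rfl | hy
  · rw [hM.lDvd_antisymm (h.2.2 x (LDvd.refl x) (one_lDvd x)) h.1]
    exact .inr hx
  · exact .inr (.lcm hx hy h)

namespace IsGarsideElement

variable (hD : IsGarsideElement D)
include hD

theorem lDvd_of_isAtomElt (hx : IsAtomElt x) : LDvd x D := by
  induction x using Submonoid.dense_induction _ hD.generate with
  | mem x hxD => exact hxD
  | one => exact absurd rfl hx.1
  | mul x y hxD hyD =>
    rcases hx.2 x y rfl with rfl | rfl
    · rw [one_mul] at hx ⊢
      exact hyD hx
    · rw [mul_one] at hx ⊢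
      exact hxD hx

theorem lDvd_of_isSimple (hx : IsSimple x) : LDvd x D := by
  have lDvd_iff_rDvd (w : M) : LDvd w D ↔ RDvd w D := Set.ext_iff.1 hD.divisors_eq w
  induction hx with
  | atom ha => exact hD.lDvd_of_isAtomElt ha
  | @compl x y z _ _ h hx hy =>
    obtain ⟨c, hc⟩ := (lDvd_iff_rDvd _).1 (h.2.2 D hx hy)
    exact (lDvd_iff_rDvd z).2 ⟨c * x, by rw [mul_assoc, hc]⟩
  | lcm _ _ h hx hy => exact h.2.2 D hx hy

theorem finite_setOf_isSimple : {x : M | IsSimple x}.Finite :=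
  hD.finite_divisors.subset fun _ => hD.lDvd_of_isSimple

end IsGarsideElement

/-- The fundamental element of a Garside monoid: its left divisors and its right divisors are
the simple elements and `1`. In particular it is the right lcm of the simple elements. -/
structure IsFundamental (D : M) : Prop where
  lDvd_iff : ∀ x, LDvd x D ↔ IsSimpleOrOne x
  rDvd_iff : ∀ x, RDvd x D ↔ IsSimpleOrOne x

/-- The right lcm `D` of the finitely many simple elements is simple, so its right divisors are
simple. Hence `x ↦ x \ D` is an injection of the finite set of simple elements into itself; as it
is surjective, the simple elements are right divisors of `D`, and nothing else divides `D` on the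
left. -/
theorem IsAtomicMonoid.exists_isFundamental [IsRightCancelMul M] (hM : IsAtomicMonoid M)
    (hlcm : ∀ x y : M, ∃ z, IsRightLcm x y z) (hfin : {x : M | IsSimple x}.Finite) :
    ∃ D : M, IsFundamental D := by
  have finite_simpleOrOne : {x : M | IsSimpleOrOne x}.Finite := hfin.insert 1
  have : Finite {x : M // IsSimpleOrOne x} := finite_simpleOrOne
  have : Nonempty {x : M // IsSimpleOrOne x} := ⟨⟨1, .inl rfl⟩⟩
  have directed : Directed LDvd (Subtype.val : {x : M // IsSimpleOrOne x} → M) := by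
    rintro ⟨x, hx⟩ ⟨y, hy⟩
    obtain ⟨z, hz⟩ := hlcm x y
    exact ⟨⟨z, hx.rightLcm hM hy hz⟩, hz.1, hz.2.1⟩
  obtain ⟨⟨D, hD⟩, hDmax⟩ := directed.finite_le id
  have lDvd_of_simple (x : M) (hx : IsSimpleOrOne x) : LDvd x D := hDmax ⟨x, hx⟩
  have simple_of_mul_eq {x y : M} (h : x * y = D) : IsSimpleOrOne y := (h ▸ hD).of_mul_left hM x
  choose! compl mul_compl using lDvd_of_simple
  have compl_injOn : Set.InjOn compl {x | IsSimpleOrOne x} := fun x hx y hy hxy =>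
    mul_right_cancel ((mul_compl x hx).trans (hxy ▸ (mul_compl y hy).symm))
  have compl_bijOn := (finite_simpleOrOne.injOn_iff_bijOn_of_mapsTo
    fun x hx => simple_of_mul_eq (mul_compl x hx)).1 compl_injOn
  have exists_mul_eq {y : M} (hy : IsSimpleOrOne y) : ∃ x, IsSimpleOrOne x ∧ x * y = D := by
    obtain ⟨x, hx, rfl⟩ := compl_bijOn.surjOn hy
    exact ⟨x, hx, mul_compl x hx⟩
  refine ⟨D, fun x => ⟨?_, fun hx => ⟨compl x, mul_compl x hx⟩⟩, fun y => ⟨?_, fun hy => ?_⟩⟩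
  · rintro ⟨y, hxy⟩
    obtain ⟨x', hx', hx'y⟩ := exists_mul_eq (simple_of_mul_eq hxy)
    exact mul_right_cancel (hx'y.trans hxy.symm) ▸ hx'
  · exact fun ⟨x, hxy⟩ => simple_of_mul_eq hxy
  · obtain ⟨x, -, hxy⟩ := exists_mul_eq hy
    exact ⟨x, hxy⟩

namespace IsFundamental

variable (hD : IsFundamental D)
include hD

theorem lDvd_iff_rDvd : LDvd x D ↔ RDvd x D := (hD.lDvd_iff x).trans (hD.rDvd_iff x).symm

theorem isRightLcmOfSet : IsRightLcmOfSet {x : M | IsSimple x} D := by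
  refine ⟨fun x hx => (hD.lDvd_iff x).2 (.inr hx), fun m hm => ?_⟩
  rcases (hD.lDvd_iff D).1 (LDvd.refl D) with rfl | h
  · exact one_lDvd m
  · exact hm D h

variable (hM : IsAtomicMonoid M)
include hM

theorem exists_semiconjBy_left (m : M) : ∃ m', SemiconjBy D m' m := by
  induction m using Submonoid.dense_induction _ hM.generate with
  | mem a ha =>
    obtain ⟨b, hb⟩ := (hD.lDvd_iff a).2 (.inr (.atom ha))
    obtain ⟨c, hc⟩ := hD.lDvd_iff_rDvd.2 ⟨a, hb⟩
    exact ⟨c, by rw [SemiconjBy, ← hb, mul_assoc, hc]; rw [hb]⟩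
  | one => exact ⟨1, SemiconjBy.one_right D⟩
  | mul x y hx hy =>
    obtain ⟨x', hx⟩ := hx
    obtain ⟨y', hy⟩ := hy
    exact ⟨x' * y', hx.mul_right hy⟩

theorem exists_semiconjBy_right (m : M) : ∃ m', SemiconjBy D m m' := by
  induction m using Submonoid.dense_induction _ hM.generate with
  | mem a ha =>
    obtain ⟨b, hb⟩ := (hD.rDvd_iff a).2 (.inr (.atom ha))
    obtain ⟨c, hc⟩ := hD.lDvd_iff_rDvd.1 ⟨a, hb⟩
    exact ⟨c, by rw [SemiconjBy]; nth_rw 2 [← hb]; rw [← mul_assoc, hc]⟩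
  | one => exact ⟨1, SemiconjBy.one_right D⟩
  | mul x y hx hy =>
    obtain ⟨x', hx⟩ := hx
    obtain ⟨y', hy⟩ := hy
    exact ⟨x' * y', hx.mul_right hy⟩

theorem exists_semiconjBy_pow_left (n : ℕ) (m : M) : ∃ m', SemiconjBy (D ^ n) m' m := by
  induction n generalizing m with
  | zero => exact ⟨m, by simp⟩
  | succ n ih =>
    obtain ⟨a, ha⟩ := ih m
    obtain ⟨b, hb⟩ := hD.exists_semiconjBy_left hM a
    exact ⟨b, pow_succ D n ▸ ha.mul_left hb⟩

theorem exists_lDvd_pow (m : M) : ∃ n : ℕ, LDvd m (D ^ n) := by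
  induction m using Submonoid.dense_induction _ hM.generate with
  | mem a ha => exact ⟨1, by simpa using (hD.lDvd_iff a).2 (.inr (.atom ha))⟩
  | one => exact ⟨0, one_lDvd _⟩
  | mul x y hx hy =>
    obtain ⟨n, u, hu⟩ := hx
    obtain ⟨k, v, hv⟩ := hy
    obtain ⟨u', hu'⟩ := hD.exists_semiconjBy_pow_left hM k u
    refine ⟨n + k, v * u', ?_⟩
    calc x * y * (v * u') = x * (D ^ k * u') := by rw [← hv]; simp only [mul_assoc]
      _ = D ^ (n + k) := by rw [hu'.eq, ← mul_assoc, hu, pow_add]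

end IsFundamental

end Monoid

section LeftDivisibilityOrder

variable {M G : Type*} [Monoid M] [Group G] {ι : M →* G}

/-- The order of `G` is left divisibility by the image of `M`: the left-invariant order whose
positive cone is `M`. -/
structure IsLeftDivisibilityOrder [LE G] (ι : M →* G) : Prop where
  le_iff : ∀ {g h : G}, g ≤ h ↔ ∃ m, g * ι m = h

theorem IsAtomicMonoid.exists_partialOrder (hM : IsAtomicMonoid M)
    (hι : Function.Injective ι) : ∃ _ : PartialOrder G, IsLeftDivisibilityOrder ι := by
  let order : PartialOrder G :=
   { le := fun g h => ∃ m, g * ι m = h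
     le_refl := fun g => ⟨1, by simp⟩
     le_trans := by
      rintro g _ _ ⟨m, rfl⟩ ⟨n, rfl⟩
      exact ⟨m * n, by rw [map_mul, mul_assoc]⟩
     le_antisymm := by
      rintro g _ ⟨m, rfl⟩ ⟨n, hn⟩
      have mul_eq_one : m * n = 1 := hι (by simpa [mul_assoc] using hn)
      rw [(hM.eq_one_of_mul_eq_one mul_eq_one).1, map_one, mul_one] }
  exact ⟨order, ⟨Iff.rfl⟩⟩

theorem IsGroupOfFractions.exists_common_left_factor (hι : IsGroupOfFractions ι) (g h : G) :
    ∃ c a b, g = c * ι a ∧ h = c * ι b := by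
  obtain ⟨a, b, hab⟩ := hι.fraction (g⁻¹ * h)
  refine ⟨g * (ι a)⁻¹, a, b, (inv_mul_cancel_right g _).symm, ?_⟩
  rw [mul_assoc, ← hab, mul_inv_cancel_left]

namespace IsLeftDivisibilityOrder

section Preorder

variable [Preorder G] (hle : IsLeftDivisibilityOrder ι)
include hle

theorem mulLeftMono : MulLeftMono G where
  elim c g _ h := by
    obtain ⟨m, rfl⟩ := hle.le_iff.1 h
    exact hle.le_iff.2 ⟨m, mul_assoc c g _⟩

theorem one_le_iff {g : G} : 1 ≤ g ↔ ∃ m, ι m = g := by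
  simp only [hle.le_iff, one_mul]

theorem map_le_map_iff (hι : Function.Injective ι) {x y : M} : ι x ≤ ι y ↔ LDvd x y := by
  simp only [hle.le_iff, ← map_mul, hι.eq_iff, LDvd]

theorem map_le_iff {x : M} {g : G} : ι x ≤ g ↔ ∃ y, LDvd x y ∧ ι y = g := by
  simp [hle.le_iff, LDvd]

theorem isLUB_map {x y z : M} (h : IsRightLcm x y z) (hι : Function.Injective ι) (c : G) :
    IsLUB {c * ι x, c * ι y} (c * ι z) := by
  have := hle.mulLeftMono
  suffices IsLUB {ι x, ι y} (ι z) by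
    simpa only [Set.image_pair, OrderIso.mulLeft_apply] using
      (OrderIso.isLUB_image' (OrderIso.mulLeft c)).2 this
  rw [IsLUB, IsLeast, mem_upperBounds, mem_lowerBounds]
  simp only [Set.forall_mem_insert, Set.mem_singleton_iff, forall_eq, hle.map_le_map_iff hι]
  refine ⟨⟨h.1, h.2.1⟩, fun g hg => ?_⟩
  obtain ⟨hxg, hyg⟩ := by simpa [upperBounds] using hg
  obtain ⟨m, hxm, rfl⟩ := hle.map_le_iff.1 hxg
  exact (hle.map_le_map_iff hι).2 (h.2.2 m hxm ((hle.map_le_map_iff hι).1 hyg))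

/-- A lower bound `b` of two elements of `M` may lie outside `M`; its supremum with `1` is a lower
bound that lies in `M`. -/
theorem isGLB_map {x y z : M} (h : IsLeftGcd x y z) (hι : IsGroupOfFractions ι)
    (hlcm : ∀ x y : M, ∃ z, IsRightLcm x y z) : IsGLB {ι x, ι y} (ι z) := by
  constructor
  · simpa [lowerBounds, hle.map_le_map_iff hι.injective] using And.intro h.1 h.2.1
  · intro b hb
    obtain ⟨hbx, hby⟩ := by simpa [lowerBounds] using hb
    obtain ⟨c, a₁, a₂, rfl, hone⟩ := hι.exists_common_left_factor b 1
    obtain ⟨s, hs⟩ := hlcm a₁ a₂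
    have isLUB := hle.isLUB_map hs hι.injective c
    rw [← hone] at isLUB
    obtain ⟨m, hm⟩ := hle.one_le_iff.1 (isLUB.1 (Set.mem_insert_of_mem _ rfl))
    have lDvd_of_le (w : M) (hw : c * ι a₁ ≤ ι w) : LDvd m w := by
      rw [← hle.map_le_map_iff hι.injective, hm]
      refine isLUB.2 ?_
      simpa [upperBounds] using And.intro hw (hle.one_le_iff.2 ⟨w, rfl⟩)
    calc c * ι a₁ ≤ ι m := hm ▸ isLUB.1 (Set.mem_insert _ _)
      _ ≤ ι z := (hle.map_le_map_iff hι.injective).2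
        (h.2.2 m (lDvd_of_le x hbx) (lDvd_of_le y hby))

end Preorder

end IsLeftDivisibilityOrder

theorem IsGroupOfFractions.exists_semilatticeInf (hι : IsGroupOfFractions ι)
    (hM : IsAtomicMonoid M) (hlcm : ∀ x y : M, ∃ z, IsRightLcm x y z) :
    ∃ _ : SemilatticeInf G, IsLeftDivisibilityOrder ι := by
  obtain ⟨_, hle⟩ := hM.exists_partialOrder hι.injective
  have := hle.mulLeftMono
  have exists_isGLB (g h : G) : ∃ d, IsGLB {g, h} d := by
    obtain ⟨c, a, b, rfl, rfl⟩ := hι.exists_common_left_factor g h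
    obtain ⟨d, hd⟩ := hM.exists_isLeftGcd hlcm a b
    refine ⟨c * ι d, ?_⟩
    simpa only [Set.image_pair, OrderIso.mulLeft_apply] using
      (OrderIso.isGLB_image' (OrderIso.mulLeft c)).2 (hle.isGLB_map hd hι hlcm)
  choose inf isGLB_inf using exists_isGLB
  exact ⟨SemilatticeInf.ofIsGLB inf isGLB_inf, ⟨hle.le_iff⟩⟩

namespace IsLeftDivisibilityOrder

variable [SemilatticeInf G] (hle : IsLeftDivisibilityOrder ι) {D x y z : M}
include hle

theorem isLeftGcd_iff (hι : Function.Injective ι) : IsLeftGcd x y z ↔ ι x ⊓ ι y = ι z := by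
  have isLeftGcd_of_eq {d : M} (hd : ι x ⊓ ι y = ι d) : IsLeftGcd x y d := by
    simp only [IsLeftGcd, ← hle.map_le_map_iff hι, ← hd]
    exact ⟨inf_le_left, inf_le_right, fun _ => le_inf⟩
  refine ⟨fun h => ?_, isLeftGcd_of_eq⟩
  obtain ⟨d, hd⟩ := hle.one_le_iff.1
    (le_inf (hle.one_le_iff.2 ⟨x, rfl⟩) (hle.one_le_iff.2 ⟨y, rfl⟩))
  have isLeftGcd := isLeftGcd_of_eq hd.symm
  rw [← hd]
  exact le_antisymm ((hle.map_le_map_iff hι).2 (h.2.2 d isLeftGcd.1 isLeftGcd.2.1))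
    ((hle.map_le_map_iff hι).2 (isLeftGcd.2.2 z h.1 h.2.1))

theorem starCoprime_iff (hι : Function.Injective ι) (hx : LDvd x D) :
    StarCoprime D x y ↔ ι x * ι y ⊓ ι D = ι x := by
  have := hle.mulLeftMono
  have isLeftGcd_compl_iff {c : M} (hc : x * c = D) :
      IsLeftGcd c y 1 ↔ ι x * ι y ⊓ ι D = ι x := by
    rw [hle.isLeftGcd_iff hι, map_one, ← hc, map_mul, inf_comm, ← mul_inf_distrib, mul_eq_left]
  constructor
  · rintro ⟨c, hc, hcy⟩
    refine (isLeftGcd_compl_iff (hι ?_)).1 hcy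
    exact le_antisymm ((hle.map_le_map_iff hι).2 (hc.2.2 D hx (LDvd.refl D)))
      ((hle.map_le_map_iff hι).2 hc.2.1)
  · intro h
    obtain ⟨c, rfl⟩ := hx
    exact ⟨c, ⟨⟨c, rfl⟩, LDvd.refl _, fun _ _ hm => hm⟩, (isLeftGcd_compl_iff rfl).2 h⟩

theorem isQuasiCentralUnit (hD : IsFundamental D) (hM : IsAtomicMonoid M) :
    IsQuasiCentralUnit (ι D) where
  one_le := hle.one_le_iff.2 ⟨D, rfl⟩
  mul_le_mul_iff a b := by
    rw [hle.le_iff, hle.le_iff]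
    constructor
    · rintro ⟨m, hm⟩
      obtain ⟨m', hm'⟩ := hD.exists_semiconjBy_right hM m
      refine ⟨m', mul_right_cancel (b := ι D) ?_⟩
      rw [← hm, mul_assoc, mul_assoc, ← map_mul, ← map_mul, hm'.eq]
    · rintro ⟨m, rfl⟩
      obtain ⟨m', hm'⟩ := hD.exists_semiconjBy_left hM m
      exact ⟨m', by rw [mul_assoc, mul_assoc, ← map_mul, hm'.eq, map_mul]⟩
  exists_le_pow a ha := by
    obtain ⟨m, rfl⟩ := hle.one_le_iff.1 ha
    obtain ⟨n, hn⟩ := hD.exists_lDvd_pow hM m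
    exact ⟨n, by rw [← map_pow]; exact hle.map_le_iff.2 ⟨_, hn, rfl⟩⟩

end IsLeftDivisibilityOrder

end LeftDivisibilityOrder

section LetterWords

variable {M G : Type*} [Monoid M] [Group G]

/-- The word `x_p⁻¹ ⋯ x₁⁻¹ y₁ ⋯ y_q` on letters; `mixedWord` is its image in the group. -/
def letterWord (xs ys : List (Simples M)) : List (Letter M) :=
  xs.reverse.map Sum.inr ++ ys.map Sum.inl

/-- The element of `G` that a simple element represents. -/
def simpleVal (ι : M →* G) (s : Simples M) : G := ι s.1

theorem simpleVal_injective {ι : M →* G} (hι : Function.Injective ι) :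
    Function.Injective (simpleVal ι) :=
  hι.comp Subtype.val_injective

theorem map_letterVal_letterWord (ι : M →* G) (xs ys : List (Simples M)) :
    (letterWord xs ys).map (letterVal ι) =
      mixedWord (xs.map (simpleVal ι)) (ys.map (simpleVal ι)) := by
  simp [letterWord, mixedWord, letterVal, simpleVal, Function.comp_def]

theorem wordVal_letterWord (ι : M →* G) (xs ys : List (Simples M)) :
    Automatic.wordVal (letterVal ι) (letterWord xs ys) =
      (xs.map (simpleVal ι)).prod⁻¹ * (ys.map (simpleVal ι)).prod := by
  rw [Automatic.wordVal, map_letterVal_letterWord, prod_mixedWord]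

theorem exists_letterVal_eq_inv (ι : M →* G) (a : Letter M) :
    ∃ b, letterVal ι b = (letterVal ι a)⁻¹ := by
  rcases a with s | s
  · exact ⟨.inr s, rfl⟩
  · exact ⟨.inl s, (inv_inv _).symm⟩

end LetterWords

section Regularity

variable {M : Type*} [Monoid M] {D : M}

/-- The condition on a letter of a left normal form. -/
def IsNontrivialLetter : Letter M → Prop :=
  Sum.elim (fun s => s.1 ≠ 1) (fun s => s.1 ≠ 1)

/-- The condition on two consecutive letters of a left normal form. -/
def FormStep (D : M) : Letter M → Letter M → Prop
  | .inr x, .inr x' => StarCoprime D x'.1 x.1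
  | .inr x, .inl y => IsLeftGcd x.1 y.1 1
  | .inl y, .inl y' => StarCoprime D y.1 y'.1
  | .inl _, .inr _ => False

theorem exists_eq_letterWord_of_isChain {w : List (Letter M)} (h : w.IsChain (FormStep D)) :
    ∃ xs ys, w = letterWord xs ys := by
  induction w with
  | nil => exact ⟨[], [], rfl⟩
  | cons a w ih =>
    rw [List.isChain_cons] at h
    obtain ⟨xs, ys, rfl⟩ := ih h.2
    rcases a with y | x
    · rcases List.eq_nil_or_concat xs with rfl | ⟨xs, x, rfl⟩
      · exact ⟨[], y :: ys, by simp [letterWord]⟩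
      · exact (h.1 (.inr x) (by simp [letterWord])).elim
    · exact ⟨xs ++ [x], ys, by simp [letterWord]⟩

theorem letterWord_mem_localLanguage_iff {xs ys : List (Simples M)} :
    letterWord xs ys ∈ Automatic.localLanguage IsNontrivialLetter (FormStep D) ↔
      IsNormalSeq D xs ∧ IsNormalSeq D ys ∧
        ∀ x ∈ xs.head?, ∀ y ∈ ys.head?, IsLeftGcd x.1 y.1 1 := by
  rw [letterWord, Automatic.append_mem_localLanguage]
  simp only [Automatic.mem_localLanguage, IsNontrivialLetter, FormStep, IsNormalSeq,
    List.forall_mem_map, List.isChain_map, List.isChain_reverse, List.mem_reverse,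
    List.map_reverse, List.getLast?_reverse, List.head?_map, Option.mem_map,
    forall_exists_index, and_imp, forall_apply_eq_imp_iff₂, Sum.elim_inl, Sum.elim_inr]

theorem leftNormalForms_eq_localLanguage (D : M) :
    leftNormalForms D = Automatic.localLanguage IsNontrivialLetter (FormStep D) := by
  ext w
  constructor
  · rintro ⟨xs, ys, hx, hy, hxy, rfl⟩
    exact letterWord_mem_localLanguage_iff.2 ⟨hx, hy, hxy⟩
  · intro hw
    obtain ⟨xs, ys, rfl⟩ := exists_eq_letterWord_of_isChain hw.2
    obtain ⟨hx, hy, hxy⟩ := letterWord_mem_localLanguage_iff.1 hw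
    exact ⟨xs, ys, hx, hy, hxy, rfl⟩

theorem isRegular_leftNormalForms [Finite (Simples M)] (D : M) :
    (leftNormalForms D).IsRegular := by
  rw [leftNormalForms_eq_localLanguage]
  exact Automatic.isRegular_localLanguage _ _

end Regularity

section NormalForms

open Automatic

variable {M G : Type*} [Monoid M] [Group G] [SemilatticeInf G] {ι : M →* G} {D : M}
  (hle : IsLeftDivisibilityOrder ι) (hι : Function.Injective ι) (hD : IsFundamental D)
include hle hι hD

theorem mem_Icc_iff {g : G} : g ∈ Set.Icc 1 (ι D) ↔ g = 1 ∨ ∃ s, simpleVal ι s = g := by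
  constructor
  · rintro ⟨one_le, le⟩
    obtain ⟨m, rfl⟩ := hle.one_le_iff.1 one_le
    rcases (hD.lDvd_iff m).1 ((hle.map_le_map_iff hι).1 le) with rfl | hm
    · exact .inl (map_one ι)
    · exact .inr ⟨⟨m, hm⟩, rfl⟩
  · rintro (rfl | ⟨s, rfl⟩)
    · exact ⟨le_rfl, hle.one_le_iff.2 ⟨D, rfl⟩⟩
    · exact ⟨hle.one_le_iff.2 ⟨s.1, rfl⟩,
        (hle.map_le_map_iff hι).2 ((hD.lDvd_iff s.1).2 (.inr s.2))⟩

theorem isNormalSeq_iff {l : List (Simples M)} :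
    IsNormalSeq D l ↔ IsGreedy (ι D) (l.map (simpleVal ι)) := by
  have ne_one_iff (s : Simples M) : s.1 ≠ 1 ↔ simpleVal ι s ∈ Set.Ioc 1 (ι D) := by
    have mem_Icc := (mem_Icc_iff hle hι hD).2 (.inr ⟨s, rfl⟩)
    rw [Set.mem_Ioc, and_iff_left mem_Icc.2, mem_Icc.1.lt_iff_ne', simpleVal, ne_eq, ne_eq,
      map_eq_one_iff ι hι]
  have starCoprime_iff (s t : Simples M) :
      StarCoprime D s.1 t.1 ↔ simpleVal ι s * simpleVal ι t ⊓ ι D = simpleVal ι s :=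
    hle.starCoprime_iff hι ((hD.lDvd_iff s.1).2 (.inr s.2))
  simp only [IsNormalSeq, IsGreedy, List.isChain_map, List.forall_mem_map, ne_one_iff,
    starCoprime_iff]

theorem mem_leftNormalForms_iff {w : List (Letter M)} :
    w ∈ leftNormalForms D ↔ ∃ xs ys,
      IsMixedForm (ι D) (xs.map (simpleVal ι)) (ys.map (simpleVal ι)) ∧ w = letterWord xs ys := by
  refine exists₂_congr fun xs ys => ?_
  have coprime_iff : (∀ x ∈ xs.head?, ∀ y ∈ ys.head?, IsLeftGcd x.1 y.1 1) ↔
      ∀ x ∈ (xs.map (simpleVal ι)).head?, ∀ y ∈ (ys.map (simpleVal ι)).head?, x ⊓ y = 1 := by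
    simp only [List.head?_map, Option.mem_map, forall_exists_index, and_imp,
      forall_apply_eq_imp_iff₂, hle.isLeftGcd_iff hι, map_one, simpleVal]
  rw [isNormalSeq_iff hle hι hD, isNormalSeq_iff hle hι hD, coprime_iff]
  exact ⟨fun ⟨hx, hy, hxy, hw⟩ => ⟨⟨hx, hy, hxy⟩, hw⟩,
    fun ⟨⟨hx, hy, hxy⟩, hw⟩ => ⟨hx, hy, hxy, hw⟩⟩

theorem exists_map_simpleVal_eq {l : List G} (h : IsGreedy (ι D) l) :
    ∃ xs : List (Simples M), xs.map (simpleVal ι) = l := by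
  suffices l ∈ Set.range (List.map (simpleVal ι)) from this
  rw [Set.range_list_map]
  intro s hs
  obtain ⟨one_lt, le⟩ := h.1 s hs
  exact ((mem_Icc_iff hle hι hD).1 ⟨one_lt.le, le⟩).resolve_left one_lt.ne'

theorem lengthLE_one_iff_isAdjacent {g : G} :
    LengthLE (letterVal ι) 1 g ↔ IsAdjacent (ι D) 1 g := by
  have := hle.mulLeftMono
  rw [isAdjacent_iff, inv_one, one_mul, mem_Icc_iff hle hι hD, mem_Icc_iff hle hι hD]
  constructor
  · rintro ⟨w, hw, rfl⟩
    rcases w with _ | ⟨s | s, _ | ⟨b, w⟩⟩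
    · exact .inl (.inl rfl)
    · exact .inl (.inr ⟨s, by simp [wordVal, letterVal, simpleVal]⟩)
    · simp at hw
    · exact .inr (.inr ⟨s, by simp [wordVal, letterVal, simpleVal]⟩)
    · simp at hw
  · rintro ((rfl | ⟨s, rfl⟩) | (h | ⟨s, h⟩))
    · exact ⟨[], zero_le_one, rfl⟩
    · exact ⟨[.inl s], le_rfl, by simp [wordVal, letterVal, simpleVal]⟩
    · exact ⟨[], zero_le_one, (inv_eq_one.1 h).symm⟩
    · exact ⟨[.inr s], le_rfl, by simpa [wordVal, letterVal, simpleVal, inv_eq_iff_eq_inv] using h⟩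

theorem distLE_one_iff_isAdjacent {a b : G} :
    DistLE (letterVal ι) 1 a b ↔ IsAdjacent (ι D) a b := by
  have := hle.mulLeftMono
  rw [DistLE, lengthLE_one_iff_isAdjacent hle hι hD, isAdjacent_iff, isAdjacent_iff, inv_one,
    one_mul]

variable (hM : IsAtomicMonoid M)
include hM

theorem existsUnique_leftNormalForm (g : G) :
    ∃! w : List (Letter M), w ∈ leftNormalForms D ∧ wordVal (letterVal ι) w = g := by
  have := hle.mulLeftMono
  have isQuasiCentralUnit := hle.isQuasiCentralUnit hD hM
  simp only [mem_leftNormalForms_iff hle hι hD]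
  apply existsUnique_of_exists_of_unique
  · obtain ⟨_, _, h, rfl⟩ := isQuasiCentralUnit.exists_isMixedForm g
    obtain ⟨xs, rfl⟩ := exists_map_simpleVal_eq hle hι hD h.left
    obtain ⟨ys, rfl⟩ := exists_map_simpleVal_eq hle hι hD h.right
    exact ⟨_, ⟨xs, ys, h, rfl⟩, wordVal_letterWord ι xs ys⟩
  · rintro _ _ ⟨⟨xs, ys, h, rfl⟩, rfl⟩ ⟨⟨xs', ys', h', rfl⟩, heq⟩
    rw [wordVal_letterWord, wordVal_letterWord] at heq
    obtain ⟨hx, hy⟩ := isQuasiCentralUnit.eq_of_isMixedForm h h' heq.symm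
    have map_injective := (simpleVal_injective hι).list_map
    rw [map_injective hx, map_injective hy]

theorem wordVal_take_eq_mixedPath {w : List (Letter M)} (hw : w ∈ leftNormalForms D) (t : ℕ) :
    wordVal (letterVal ι) (w.take t) = mixedPath (ι D) (wordVal (letterVal ι) w) t := by
  have := hle.mulLeftMono
  obtain ⟨xs, ys, h, rfl⟩ := (mem_leftNormalForms_iff hle hι hD).1 hw
  rw [wordVal_letterWord, ← (hle.isQuasiCentralUnit hD hM).prod_take_mixedWord h, wordVal,
    List.map_take, map_letterVal_letterWord]

theorem rightFellowTraveller_leftNormalForms :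
    RightFellowTraveller (letterVal ι) (leftNormalForms D) 1 := by
  have := hle.mulLeftMono
  intro u hu v hv g hg huv t
  rw [lengthLE_one_iff_isAdjacent hle hι hD] at hg
  rw [distLE_one_iff_isAdjacent hle hι hD, wordVal_take_eq_mixedPath hle hι hD hM hu,
    wordVal_take_eq_mixedPath hle hι hD hM hv, huv]
  exact (hle.isQuasiCentralUnit hD hM).isAdjacent_mixedPath_mul_right _ hg t

theorem leftFellowTraveller_leftNormalForms :
    LeftFellowTraveller (letterVal ι) (leftNormalForms D) 1 := by
  have := hle.mulLeftMono
  intro u hu v hv g hg huv t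
  rw [lengthLE_one_iff_isAdjacent hle hι hD] at hg
  rw [distLE_one_iff_isAdjacent hle hι hD, wordVal_take_eq_mixedPath hle hι hD hM hu,
    wordVal_take_eq_mixedPath hle hι hD hM hv, huv]
  exact (hle.isQuasiCentralUnit hD hM).isAdjacent_mixedPath_mul_left _ hg t

theorem isRegularBicombing_leftNormalForms [Finite (Simples M)] :
    IsRegularBicombing (letterVal ι) (leftNormalForms D) 1 where
  inv_closed := exists_letterVal_eq_inv ι
  regular := isRegular_leftNormalForms D
  surjective g := (existsUnique_leftNormalForm hle hι hD hM g).exists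
  right_fellowTraveller := rightFellowTraveller_leftNormalForms hle hι hD hM
  left_fellowTraveller := leftFellowTraveller_leftNormalForms hle hι hD hM

end NormalForms

end Garside

theorem mainTheorem1_general {M : Type*} [Monoid M] (hM : Garside.IsAtomicMonoid M)
    (hlcm : ∀ x y : M, ∃ z, Garside.IsRightLcm x y z)
    (hfin : {x : M | Garside.IsSimple x}.Finite)
    {G : Type*} [Group G] (ι : M →* G) (hι : Garside.IsGroupOfFractions ι) :
    Automatic.IsBiautomaticGroup G ∧
    ∃ Δ : M, Garside.IsRightLcmOfSet {x : M | Garside.IsSimple x} Δ ∧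
      (∀ g : G, ∃! w : List (Garside.Letter M),
        w ∈ Garside.leftNormalForms Δ ∧ Automatic.wordVal (Garside.letterVal ι) w = g) ∧
      Automatic.IsBiautomaticStructure (Garside.letterVal ι) (Garside.leftNormalForms Δ) ∧
      Automatic.RightFellowTraveller (Garside.letterVal ι) (Garside.leftNormalForms Δ) 1 ∧
      Automatic.LeftFellowTraveller (Garside.letterVal ι) (Garside.leftNormalForms Δ) 1 := by
  have : IsRightCancelMul M := hι.injective.isRightCancelMul ι (map_mul ι)
  have : Finite (Garside.Simples M) := hfin
  obtain ⟨Δ, hΔ⟩ := hM.exists_isFundamental hlcm hfin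
  obtain ⟨_, hle⟩ := hι.exists_semilatticeInf hM hlcm
  have bicombing := Garside.isRegularBicombing_leftNormalForms hle hι.injective hΔ hM
  exact ⟨bicombing.isBiautomaticGroup, Δ, hΔ.isRightLcmOfSet,
    Garside.existsUnique_leftNormalForm hle hι.injective hΔ hM,
    bicombing.isBiautomaticStructure, bicombing.right_fellowTraveller,
    bicombing.left_fellowTraveller⟩

theorem mainTheorem1 {M : Type*} [Monoid M] (hM : Garside.IsGarsideMonoid M)
    {G : Type*} [Group G] (ι : M →* G) (hι : Garside.IsGroupOfFractions ι) :
    Automatic.IsBiautomaticGroup G ∧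
    ∃ Δ : M, Garside.IsRightLcmOfSet {x : M | Garside.IsSimple x} Δ ∧
      (∀ g : G, ∃! w : List (Garside.Letter M),
        w ∈ Garside.leftNormalForms Δ ∧ Automatic.wordVal (Garside.letterVal ι) w = g) ∧
      Automatic.IsBiautomaticStructure (Garside.letterVal ι) (Garside.leftNormalForms Δ) ∧
      Automatic.RightFellowTraveller (Garside.letterVal ι) (Garside.leftNormalForms Δ) 2 ∧
      Automatic.LeftFellowTraveller (Garside.letterVal ι) (Garside.leftNormalForms Δ) 2 := by
  obtain ⟨Δ₀, hΔ₀⟩ := hM.garside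
  obtain ⟨biautomatic, Δ, isRightLcm, existsUnique, biautomaticStructure, right, left⟩ :=
    mainTheorem1_general hM.gaussian.atomic hM.gaussian.right_lcm hΔ₀.finite_setOf_isSimple ι hι
  exact ⟨biautomatic, Δ, isRightLcm, existsUnique, biautomaticStructure, right.mono one_le_two,
    left.mono one_le_two⟩
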